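/- Let $D\subset\mathbb R^d$ be a nonempty connected open set, with closure $\bar D$ and boundary $\partial D$. For $x\in\partial D$ and $0<r<\infty$ let $\mathcal N_{x,r}$ be the set of unit vectors $\mathbf n$ with $B(x-r\mathbf n,r)\cap D=\emptyset$, where $B(z,r)$ is the open Euclidean ball; let $\mathcal N_x=\bigcup_{0<r<\infty}\mathcal N_{x,r}$ and $\mathcal N_{x,\infty}=\bigcap_{0<r<\infty}\mathcal N_{x,r}$. Assume: (A) $r_0\in(0,\infty]$ is a constant such that $\mathcal N_x=\mathcal N_{x,r_0}\neq\emptyset$ for every $x\in\partial D$; (B) there are constants $\delta>0$ and $\beta\ge1$ such that for every $x\in\partial D$ there is a unit vector $\mathbf l_x$ with $\langle\mathbf l_x,\mathbf n\rangle\ge 1/\beta$ for every $\mathbf n\in\bigcup_{z\in B(x,\delta)\cap\partial D}\mathcal N_z$. For a càdlàg function $f:[0,\infty)\to\mathbb R^d$ write $\Delta f_t=f_t-f_{t-}$ for $t>0$, let $|f|_{[t,q]}\in[0,\infty]$ be its total variation on $[t,q]$ with respect to the Euclidean norm, and let $|f|_t=|f|_{[0,t]}$. Let $y:[0,\infty)\to\mathbb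 R^d$ be càdlàg with $y_0\in\bar D$ and $|\Delta y_t|<r_0$ for all $t>0$. Let $(x,k)$ be a solution of the Skorokhod problem associated with $y$, that is, $x,k:[0,\infty)\to\mathbb R^d$ are càdlàg and 1. $x_t=y_t+k_t$ and $x_t\in\bar D$ for all $t\ge0$; 2. $k$ has bounded variation on each finite interval, $k_0=0$, and for all $t\ge 0$ $$k_t=\int_{(0,t]}\mathbf n_s\,d|k|_s,\qquad |k|_t=\int_{(0,t]}\mathbf 1_{\{x_s\in\partial D\}}\,d|k|_s,$$ where $\mathbf n_s\in\mathcal N_{x_s}$ whenever $x_s\in\partial D$; 3. at each time the solution jumps by projection: $x_t=\Pi_{\bar D}(x_{t-}+\Delta y_t)$ for all $t>0$, that is, $x_t$ is the point of $\bar D$ nearest to $x_{t-}+\Delta y_t$. Then for all $0\le t<q$, $$|k|_{[t,q]}\le|y|_{[t,q]}\qquad\text{and}\qquad|x|_{[t,q]}\le2\,|y|_{[t,q]}.$$ -/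

import Mathlib

open Set Filter Topology MeasureTheory
open scoped NNReal ENNReal

namespace Skorokhod

section Paths

variable {E : Type*} [NormedAddCommGroup E]

/-- A càdlàg function on `[0, ∞)`: right continuous with left-hand limits. -/
structure IsCadlag (f : ℝ≥0 → E) : Prop where
  right_cont : ∀ t, ContinuousWithinAt f (Ici t) t
  left_lim : ∀ t, ∃ l, Tendsto f (𝓝[<] t) (𝓝 l)

/-- The jump `Δf_t = f_t - f_{t-}` (equal to `0` at `t = 0`, where `leftLim f 0 = f 0`). -/
noncomputable def jump (f : ℝ≥0 → E) (t : ℝ≥0) : E := f t - Function.leftLim f t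

/-- Total variation `|f|_{[a, b]}`, possibly infinite. -/
noncomputable def variation (f : ℝ≥0 → E) (a b : ℝ≥0) : ℝ≥0∞ := eVariationOn f (Icc a b)

/-- `f` has bounded variation on each finite interval. -/
def HasFiniteVariation (f : ℝ≥0 → E) : Prop := ∀ t, variation f 0 t < ∞

theorem variation_add (f : ℝ≥0 → E) {a b c : ℝ≥0} (hab : a ≤ b) (hbc : b ≤ c) :
    variation f a b + variation f b c = variation f a c := by
  simpa [variation] using eVariationOn.Icc_add_Icc f (s := univ) hab hbc (mem_univ b)

theorem HasFiniteVariation.locallyBoundedVariationOn {f : ℝ≥0 → E}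
    (hf : HasFiniteVariation f) : LocallyBoundedVariationOn f univ := by
  intro a b _ _
  exact ((eVariationOn.mono f (inter_subset_right.trans
    (Icc_subset_Icc_left (zero_le (a := a))))).trans_lt (hf b)).ne

/-- The right-continuous nondecreasing function `t ↦ |f|_t = |f|_{[0, t]}`. -/
noncomputable def variationFunction (f : ℝ≥0 → E) (hf : HasFiniteVariation f)
    (hc : IsCadlag f) : StieltjesFunction ℝ≥0 where
  toFun t := (variation f 0 t).toReal
  mono' := fun s t hst => ENNReal.toReal_mono (hf t).ne
    (eVariationOn.mono f (Icc_subset_Icc_right hst))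
  right_continuous' := by
    intro t
    rw [← continuousWithinAt_Ioi_iff_Ici]
    have h1 := hf.locallyBoundedVariationOn.tendsto_eVariationOn_Icc_right (x := t) (l := f t)
      (by simpa using (hc.right_cont t).mono_left (nhdsWithin_mono t Ioi_subset_Ici_self))
      (mem_univ t)
    simp only [univ_inter, edist_self] at h1
    have h2 : Tendsto (fun s => variation f 0 t + variation f t s) (𝓝[>] t)
        (𝓝 (variation f 0 t)) := by
      simpa [variation] using (tendsto_const_nhds (x := variation f 0 t)).add h1
    have h3 : Tendsto (fun s => variation f 0 s) (𝓝[>] t) (𝓝 (variation f 0 t)) := by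
      refine h2.congr' ?_
      filter_upwards [self_mem_nhdsWithin] with s hs
      exact variation_add f (zero_le (a := t)) (le_of_lt hs)
    exact (ENNReal.tendsto_toReal (hf t).ne).comp h3

/-- The Lebesgue–Stieltjes measure `d|f|` on `[0, ∞)`, of mass `|f|_{[a, b]}` on `(a, b]`
and of mass `0` on `{0}`. -/
noncomputable def variationMeasure (f : ℝ≥0 → E) (hf : HasFiniteVariation f)
    (hc : IsCadlag f) : Measure ℝ≥0 :=
  (variationFunction f hf hc).measure

theorem variationMeasure_Ioc (f : ℝ≥0 → E) (hf : HasFiniteVariation f) (hc : IsCadlag f)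
    {a b : ℝ≥0} (hab : a ≤ b) :
    variationMeasure f hf hc (Ioc a b) = variation f a b := by
  have h := variation_add f (zero_le (a := a)) hab
  have hb : variation f a b ≠ ∞ := ((le_add_self.trans h.le).trans_lt (hf b)).ne
  rw [variationMeasure, StieltjesFunction.measure_Ioc]
  change ENNReal.ofReal ((variation f 0 b).toReal - (variation f 0 a).toReal) = _
  rw [← h, ENNReal.toReal_add (hf a).ne hb, add_sub_cancel_left, ENNReal.ofReal_toReal hb]

end Paths

section Domain

variable {E : Type*} [NormedAddCommGroup E] [InnerProductSpace ℝ E]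

/-- `𝒩_{x,r}`: the unit vectors `n` with `B(x - r n, r) ∩ D = ∅`. -/
def normalsAt (D : Set E) (x : E) (r : ℝ) : Set E :=
  {n | ‖n‖ = 1 ∧ Metric.ball (x - r • n) r ∩ D = ∅}

/-- `𝒩_x`: the inward normal unit vectors at `x`. -/
def normals (D : Set E) (x : E) : Set E := ⋃ (r : ℝ) (_ : 0 < r), normalsAt D x r

/-- `𝒩_{x,r}` for an extended radius `r ∈ (0, ∞]`. For finite `r` this is `normalsAt D x r`
(see `normalsUpTo_ofReal`), as these sets decrease in `r`; for `r = ∞` it is the intersection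
of all `𝒩_{x,ρ}` with `ρ > 0`. -/
def normalsUpTo (D : Set E) (x : E) (r : ℝ≥0∞) : Set E :=
  {n | ∀ ρ : ℝ, 0 < ρ → ENNReal.ofReal ρ ≤ r → n ∈ normalsAt D x ρ}

theorem normalsAt_anti (D : Set E) (x : E) {ρ r : ℝ} (hρr : ρ ≤ r) :
    normalsAt D x r ⊆ normalsAt D x ρ := by
  rintro n ⟨hn, hd⟩
  refine ⟨hn, subset_empty_iff.1 (hd ▸ inter_subset_inter_left D ?_)⟩
  refine Metric.ball_subset_ball' ?_
  have h : x - ρ • n - (x - r • n) = (r - ρ) • n := by rw [sub_smul]; abel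
  rw [dist_eq_norm, h, norm_smul, hn, Real.norm_of_nonneg (sub_nonneg.2 hρr)]
  linarith

theorem normalsUpTo_ofReal (D : Set E) (x : E) {r : ℝ} (hr : 0 < r) :
    normalsUpTo D x (ENNReal.ofReal r) = normalsAt D x r := by
  ext n
  refine ⟨fun h => h r hr le_rfl, fun h ρ _ hle => normalsAt_anti D x ?_ h⟩
  exact (ENNReal.ofReal_le_ofReal_iff hr.le).1 hle

/-- Condition (A) with constant `r₀ ∈ (0, ∞]`. -/
def ConditionA (D : Set E) (r₀ : ℝ≥0∞) : Prop :=
  0 < r₀ ∧ ∀ x ∈ frontier D, normals D x = normalsUpTo D x r₀ ∧ (normals D x).Nonempty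

/-- Condition (B). -/
def ConditionB (D : Set E) : Prop :=
  ∃ δ β : ℝ, 0 < δ ∧ 1 ≤ β ∧ ∀ x ∈ frontier D, ∃ l : E, ‖l‖ = 1 ∧
    ∀ y ∈ Metric.ball x δ ∩ frontier D, ∀ n ∈ normals D y, 1 / β ≤ inner ℝ l n

/-- `(x, k)` is a solution of the Skorokhod problem (with jumps) on `closure D` associated
with `y`. The last field is the projection property of the jumps:
`x_t = Π(x_{t-} + Δy_t)`, that is, `x_t` is a point of `closure D` nearest to `x_{t-} + Δy_t`. -/
structure IsSolution (D : Set E) (y x k : ℝ≥0 → E) : Prop where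
  cadlag_x : IsCadlag x
  cadlag_k : IsCadlag k
  eq_add : ∀ t, x t = y t + k t
  mem_closure : ∀ t, x t ∈ closure D
  finite_variation : HasFiniteVariation k
  k_zero : k 0 = 0
  normal_integral : ∃ n : ℝ≥0 → E,
    (∀ s, x s ∈ frontier D → n s ∈ normals D (x s)) ∧
    ∀ t, IntegrableOn n (Ioc 0 t) (variationMeasure k finite_variation cadlag_k) ∧
      k t = ∫ s in Ioc 0 t, n s ∂(variationMeasure k finite_variation cadlag_k)
  variation_on_frontier : ∀ t, variation k 0 t =
    ∫⁻ s in Ioc 0 t, {s | x s ∈ frontier D}.indicator (fun _ => (1 : ℝ≥0∞)) s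
      ∂(variationMeasure k finite_variation cadlag_k)
  jump_projection : ∀ t, 0 < t →
    dist (Function.leftLim x t + jump y t) (x t) =
      Metric.infDist (Function.leftLim x t + jump y t) (closure D)

end Domain

end Skorokhod

/-!
On the set of times where `x ∈ ∂D`, the path `k` moves in a normal direction `n` at full speed:
`dk = n d|k|` with `‖n‖ = 1`. Hence `d|k| = ⟨n, dk⟩ = ⟨n, dx⟩ - ⟨n, dy⟩ ≤ ⟨n, dx⟩ + d|y|`, and the
bound on `k` follows once `⟨n, dx⟩` is seen not to contribute. The bound on `x = y + k` is then the
triangle inequality.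

For `x_s ∈ ∂D` the exterior ball of radius `r` at `x_s` gives, for all `u < s`,
`⟨n_s, x_s - x_u⟩ ≤ ‖x_s - x_u‖² / (2r)`, and `‖x_s - x_u‖ ≤ (d|k| + d|y|) (u, s]`
(`inner_sub_le_of_mem_normalsAt`). If `s` is not an atom of `d|y|`, the square is of smaller order
than `(d|k| + d|y|) (u, s]` as `u ↑ s`. The atoms are the jumps (`variationMeasure_singleton`), and
there `‖Δk_s‖ ≤ ‖Δy_s‖` because `x_s` is a projection of `x_{s-} + Δy_s` to `closure D`, which
contains `x_{s-}` (`IsSolution.norm_jump_le`).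

So for `d|k|`-almost every `s` one has an inequality on the intervals `(u, s]`, with `u` close to
`s`, and these local inequalities are to be integrated. `measure_le_of_forall_eventually_Ioc_le`
does this for inequalities between measures, by a covering with left-sided intervals.
`measure_le_of_inner_integral_le` reduces `⟨n_s, ∫_{(u, s]} n d|k|⟩` to that case: time is cut into
countably many sets `A` on which `n` varies by at most `2ε`, and the part of `d|k|` living outside
`A` has no mass on `A`.
-/

namespace Skorokhod

/-! ### Comparing measures through intervals ending at a point -/

/-- A one-sided covering argument: to compare two measures on `A` it suffices to compare them on
all short intervals `(u, s]` ending at points of `A`. No differentiation theorem is involved, since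
*every* short interval is admissible: points of `A` with a common threshold are covered by the
cells of a fine regular grid, cut off at their right ends. -/
theorem measure_le_of_forall_eventually_Ioc_le {μ ν : Measure ℝ≥0} [ν.OuterRegular] {A : Set ℝ≥0}
    (h : ∀ s ∈ A, 0 < s ∧ ∀ᶠ u in 𝓝[<] s, μ (Ioc u s) ≤ ν (Ioc u s)) : μ A ≤ ν A := by
  rw [A.measure_eq_iInf_isOpen ν]
  refine le_iInf₂ fun U hAU => le_iInf fun hU => ?_
  let δ : ℕ → ℝ≥0 := fun n => 1 / ((n : ℝ≥0) + 1)
  have hδ : ∀ n, 0 < δ n := fun n => by positivity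
  let B : ℕ → Set ℝ≥0 := fun n => {s | s ∈ A ∧
    ∀ u < s, s ≤ u + δ n → Ioc u s ⊆ U ∧ μ (Ioc u s) ≤ ν (Ioc u s)}
  have hBmono : Monotone B := by
    intro m n hmn s hs
    refine ⟨hs.1, fun u hu hsu => hs.2 u hu (hsu.trans ?_)⟩
    gcongr
    exact one_div_le_one_div_of_le (by positivity) (by gcongr)
  have hAB : A ⊆ ⋃ n, B n := by
    intro s hs
    obtain ⟨hs0, hs1⟩ := h s hs
    have hU' : ∀ᶠ u in 𝓝[<] s, Ioc u s ⊆ U := by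
      obtain ⟨l, hl, hlU⟩ := exists_Ioc_subset_of_mem_nhds (hU.mem_nhds (hAU hs)) ⟨0, hs0⟩
      filter_upwards [Ioo_mem_nhdsLT hl] with u hu
      exact (Ioc_subset_Ioc_left hu.1.le).trans hlU
    obtain ⟨l, hl, hls⟩ := (mem_nhdsLT_iff_exists_Ioo_subset' hs0).1 (hU'.and hs1)
    obtain ⟨n, hn⟩ := exists_nat_one_div_lt (tsub_pos_of_lt (mem_Iio.1 hl))
    refine mem_iUnion.2 ⟨n, hs, fun u hus hsu => hls ⟨?_, hus⟩⟩
    have : s < u + (s - l) := hsu.trans_lt (by gcongr)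
    have h2 : l + (s - l) < u + (s - l) := by rwa [add_tsub_cancel_of_le (le_of_lt hl)]
    exact lt_of_add_lt_add_right h2
  -- The points of `A` where the inequality holds, inside `U`, at all scales up to `δ n`, are `B n`.
  -- On a cell `(a, b]` shorter than `δ n`, the supremum of `B n` may fail to be attained, so that
  -- the cell is exhausted from the left by intervals with right end in `B n`.
  have hcell : ∀ n a b, b ≤ a + δ n → μ (B n ∩ Ioc a b) ≤ ν (U ∩ Ioc a b) := by
    intro n a b hab
    rcases (B n ∩ Ioc a b).eq_empty_or_nonempty with hemp | hne
    · simp [hemp]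
    have hbdd : BddAbove (B n ∩ Ioc a b) := ⟨b, fun s hs => hs.2.2⟩
    have hle : ∀ s ∈ B n ∩ Ioc a b, μ (Ioc a s) ≤ ν (U ∩ Ioc a b) := by
      intro s hs
      obtain ⟨h1, h2⟩ := hs.1.2 a hs.2.1 (hs.2.2.trans hab)
      exact h2.trans (measure_mono (subset_inter h1 (Ioc_subset_Ioc_right hs.2.2)))
    by_cases hmem : sSup (B n ∩ Ioc a b) ∈ B n ∩ Ioc a b
    · exact (measure_mono (t := Ioc a (sSup (B n ∩ Ioc a b)))
        fun s hs => ⟨hs.2.1, le_csSup hbdd hs⟩).trans (hle _ hmem)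
    · obtain ⟨v, hv, hlim, hvm⟩ := exists_seq_tendsto_sSup hne hbdd
      have hsub : B n ∩ Ioc a b ⊆ ⋃ j, Ioc a (v j) := by
        intro s hs
        have hlt : s < sSup (B n ∩ Ioc a b) :=
          lt_of_le_of_ne (le_csSup hbdd hs) (fun h => hmem (h ▸ hs))
        obtain ⟨j, hj⟩ := (hlim.eventually_const_lt hlt).exists
        exact mem_iUnion.2 ⟨j, hs.2.1, hj.le⟩
      have hmono : Monotone fun j => Ioc a (v j) := fun i j hij => Ioc_subset_Ioc_right (hv hij)
      exact (measure_mono hsub).trans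
        (hmono.measure_iUnion.le.trans (iSup_le fun j => hle _ (hvm j)))
  refine (measure_mono hAB).trans (hBmono.measure_iUnion.le.trans (iSup_le fun n => ?_))
  let c : ℕ → ℝ≥0 := fun i => i * δ n
  have hc : Monotone c := fun i j hij => mul_le_mul_left (Nat.cast_le.2 hij) _
  have hcover : B n ⊆ ⋃ i, B n ∩ Ioc (c i) (c (i + 1)) := by
    intro s hs
    have hs0 : 0 < s / δ n := div_pos (h s hs.1).1 (hδ n)
    obtain ⟨i, hi⟩ := Nat.exists_eq_succ_of_ne_zero (Nat.ceil_pos.2 hs0).ne'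
    refine mem_iUnion.2 ⟨i, hs, ?_, ?_⟩
    · have : (i : ℝ≥0) < s / δ n := Nat.lt_ceil.1 (by omega)
      exact (lt_div_iff₀ (hδ n)).1 this
    · have : s / δ n ≤ ((i + 1 : ℕ) : ℝ≥0) := Nat.ceil_le.1 hi.le
      exact (div_le_iff₀ (hδ n)).1 this
  calc μ (B n) ≤ ∑' i, μ (B n ∩ Ioc (c i) (c (i + 1))) :=
        (measure_mono hcover).trans (measure_iUnion_le _)
    _ ≤ ∑' i, ν (U ∩ Ioc (c i) (c (i + 1))) :=
        ENNReal.tsum_le_tsum fun i => hcell n _ _ (by simp [c, add_mul])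
    _ = ν (⋃ i, U ∩ Ioc (c i) (c (i + 1))) := by
        refine (measure_iUnion ?_ fun i => hU.measurableSet.inter measurableSet_Ioc).symm
        exact fun i j hij => ((hc.pairwise_disjoint_on_Ioc_succ hij).mono
          inter_subset_right inter_subset_right)
    _ ≤ ν U := measure_mono (iUnion_subset fun i => inter_subset_left)

theorem eventually_measure_Ioc_lt {μ : Measure ℝ≥0} [μ.OuterRegular] {s : ℝ≥0} (hs : 0 < s)
    {c : ℝ≥0∞} (hc : μ {s} < c) : ∀ᶠ u in 𝓝[<] s, μ (Ioc u s) < c := by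
  obtain ⟨U, hsU, hU, hUc⟩ := Set.exists_isOpen_lt_of_lt {s} c hc
  obtain ⟨l, hl, hlU⟩ := exists_Ioc_subset_of_mem_nhds (hU.mem_nhds (hsU rfl)) ⟨0, hs⟩
  filter_upwards [Ioo_mem_nhdsLT hl] with u hu
  exact (measure_mono ((Ioc_subset_Ioc_left hu.1.le).trans hlU)).trans_lt hUc

/-- Let `‖n‖ = 1`, so that `μ` is the variation of the vector measure `n μ`. If the component of
`(n μ) (u, s]` in the direction `n s` is at most `ν (u, s]`, up to an arbitrarily small multiple of
`(μ + ν) (u, s]` as `u ↑ s`, then `μ` has no more mass than `ν`. -/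
theorem measure_le_of_inner_integral_le {E : Type*} [NormedAddCommGroup E] [InnerProductSpace ℝ E]
    [CompleteSpace E] [SecondCountableTopology E]
    {μ ν : Measure ℝ≥0} [IsFiniteMeasure μ] [IsFiniteMeasure ν] {n : ℝ≥0 → E}
    (hn : AEStronglyMeasurable n μ) (hn1 : ∀ᵐ s ∂μ, ‖n s‖ = 1)
    (h : ∀ ε : ℝ≥0, 0 < ε → ∀ᵐ s ∂μ, 0 < s ∧ ∀ᶠ u in 𝓝[<] s,
      inner ℝ (n s) (∫ r in Ioc u s, n r ∂μ) ≤
        ε * (μ.real (Ioc u s) + ν.real (Ioc u s)) + ν.real (Ioc u s)) :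
    μ univ ≤ ν univ := by
  obtain ⟨n', hn'm, hnn'⟩ := hn
  have hint : Integrable n μ := by
    refine Integrable.of_bound ⟨n', hn'm, hnn'⟩ 1 ?_
    filter_upwards [hn1] with s hs using hs.le
  -- On a set `A` where `n'` hardly varies, `⟨n s, (n μ) (u, s]⟩` is nearly `μ (u, s]` up to the
  -- mass of `(u, s] \ A`, which enters below through `μ.restrict Aᶜ`, a measure that vanishes on `A`.
  have key : ∀ ε : ℝ≥0, 0 < ε → ∀ A : Set ℝ≥0, MeasurableSet A →
      (∀ r ∈ A, ∀ s ∈ A, ‖n' r - n' s‖ ≤ 2 * ε) → μ A ≤ 3 * ε * μ A + (1 + ε) * ν A := by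
    intro ε hε A hA hdiam
    let G : Set ℝ≥0 := {s | n s = n' s ∧ ‖n s‖ = 1 ∧ 0 < s ∧ ∀ᶠ u in 𝓝[<] s,
      inner ℝ (n s) (∫ r in Ioc u s, n r ∂μ) ≤
        ε * (μ.real (Ioc u s) + ν.real (Ioc u s)) + ν.real (Ioc u s)}
    have hG : ∀ᵐ s ∂μ, s ∈ G := by
      filter_upwards [hnn', hn1, h ε hε] with s h1 h2 h3 using ⟨h1, h2, h3⟩
    let κ : Measure ℝ≥0 := (3 * ε) • μ + (1 + ε) • ν + (2 : ℝ≥0) • μ.restrict Aᶜ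
    have hκ : ∀ B, κ B = 3 * ε * μ B + (1 + ε) * ν B + 2 * μ.restrict Aᶜ B := by
      intro B
      simp [κ, ENNReal.smul_def]
    have hAG : μ (A ∩ G) = μ A := measure_inter_conull hG
    have hle : μ (A ∩ G) ≤ κ (A ∩ G) := by
      refine measure_le_of_forall_eventually_Ioc_le fun s hs => ⟨hs.2.2.2.1, ?_⟩
      obtain ⟨hsA, hsn, hs1, hs0, hsu⟩ := hs
      filter_upwards [hsu] with u hu
      have hlow : (1 - 2 * ε) * μ.real (Ioc u s) - 2 * μ.real (Ioc u s ∩ Aᶜ) ≤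
          inner ℝ (n s) (∫ r in Ioc u s, n r ∂μ) := by
        have e1 : inner ℝ (n s) (∫ r in Ioc u s, n r ∂μ) =
            ∫ r in Ioc u s, inner ℝ (n s) (n r) ∂μ :=
          (integral_inner hint.integrableOn (n s)).symm
        have e2 : ∫ r in Ioc u s, ((1 - 2 * (ε : ℝ)) - Aᶜ.indicator (fun _ => (2 : ℝ)) r) ∂μ =
            (1 - 2 * ε) * μ.real (Ioc u s) - 2 * μ.real (Ioc u s ∩ Aᶜ) := by
          rw [integral_sub (integrable_const _) ((integrable_const _).indicator hA.compl),
            integral_indicator hA.compl]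
          simp [Measure.restrict_restrict hA.compl, inter_comm, mul_comm]
        rw [e1, ← e2]
        refine setIntegral_mono_ae ((integrable_const _).sub
          ((integrable_const _).indicator hA.compl)).integrableOn
          (hint.const_inner _).integrableOn ?_
        filter_upwards [hG] with r hr
        obtain ⟨hrn, hr1, -⟩ := hr
        have habs : -1 ≤ inner ℝ (n s) (n r) := by
          have := (abs_le.1 (abs_real_inner_le_norm (n s) (n r))).1
          rwa [hs1, hr1, mul_one] at this
        by_cases hrA : r ∈ A
        · have hd : ‖n r - n s‖ ≤ 2 * ε := by
            rw [hrn, hsn]; exact hdiam r hrA s hsA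
          have e3 : inner ℝ (n s) (n r) = 1 + inner ℝ (n s) (n r - n s) := by
            rw [inner_sub_right, real_inner_self_eq_norm_sq, hs1]; ring
          have h4 := (abs_le.1 (abs_real_inner_le_norm (n s) (n r - n s))).1
          rw [hs1, one_mul] at h4
          simp only [indicator, mem_compl_iff, hrA, not_true, if_false]
          linarith
        · simp only [indicator, mem_compl_iff, hrA, not_false_eq_true, if_true]
          have := ε.coe_nonneg
          linarith
      have hreal : μ.real (Ioc u s) ≤ 3 * ε * μ.real (Ioc u s) + (1 + ε) * ν.real (Ioc u s) +
          2 * (μ.restrict Aᶜ).real (Ioc u s) := by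
        have e4 : (μ.restrict Aᶜ).real (Ioc u s) = μ.real (Ioc u s ∩ Aᶜ) := by
          simp [measureReal_def, Measure.restrict_apply]
        rw [e4]
        linarith
      rw [hκ]
      have := ENNReal.ofReal_le_ofReal hreal
      rw [ENNReal.ofReal_add (by positivity) (by positivity),
        ENNReal.ofReal_add (by positivity) (by positivity),
        ENNReal.ofReal_mul (by positivity), ENNReal.ofReal_mul (by positivity),
        ENNReal.ofReal_mul (by positivity), ENNReal.ofReal_mul (by positivity),
        ENNReal.ofReal_add (by positivity) (by positivity)] at this
      simpa using this
    rw [hAG, hκ, hAG, Measure.restrict_apply' hA.compl] at hle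
    have h0 : A ∩ G ∩ Aᶜ = ∅ := by ext; simp; tauto
    rw [h0, measure_empty, mul_zero, add_zero] at hle
    exact hle.trans (by gcongr; exact inter_subset_left)
  -- Countably many balls of radius `ε` cover `E`; add up over their preimages, made disjoint.
  have hε : ∀ ε : ℝ≥0, 0 < ε → μ univ ≤ 3 * ε * μ univ + (1 + ε) * ν univ := by
    intro ε hε
    let C : ℕ → Set ℝ≥0 := fun i => {s | ‖n' s - TopologicalSpace.denseSeq E i‖ ≤ ε}
    have hC : ∀ i, MeasurableSet (C i) := fun i =>
      (hn'm.sub stronglyMeasurable_const).norm.measurable measurableSet_Iic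
    have hCuniv : ⋃ i, disjointed C i = univ := by
      rw [iUnion_disjointed, eq_univ_iff_forall]
      intro s
      obtain ⟨i, hi⟩ := (TopologicalSpace.denseRange_denseSeq E).exists_dist_lt (n' s)
        (NNReal.coe_pos.2 hε)
      rw [dist_eq_norm] at hi
      exact mem_iUnion.2 ⟨i, hi.le⟩
    have hm : ∀ i, MeasurableSet (disjointed C i) := MeasurableSet.disjointed hC
    have hsum : ∀ ρ : Measure ℝ≥0, ρ univ = ∑' i, ρ (disjointed C i) := fun ρ => by
      rw [← hCuniv, measure_iUnion (disjoint_disjointed C) hm]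
    rw [hsum μ, hsum ν, ← ENNReal.tsum_mul_left, ← ENNReal.tsum_mul_left, ← ENNReal.tsum_add]
    refine ENNReal.tsum_le_tsum fun i => key ε hε _ (hm i) fun r hr s hs => ?_
    have h1 : ‖_‖ ≤ (ε : ℝ) := disjointed_subset C i hr
    have h2 : ‖_‖ ≤ (ε : ℝ) := disjointed_subset C i hs
    calc ‖n' r - n' s‖ = ‖(n' r - TopologicalSpace.denseSeq E i) -
          (n' s - TopologicalSpace.denseSeq E i)‖ := by rw [sub_sub_sub_cancel_right]
      _ ≤ _ := norm_sub_le _ _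
      _ ≤ 2 * ε := by linarith
  have hlim : Tendsto (fun ε : ℝ≥0 => 3 * (ε : ℝ≥0∞) * μ univ + (1 + ε) * ν univ) (𝓝[>] 0)
      (𝓝 (3 * ((0 : ℝ≥0) : ℝ≥0∞) * μ univ + (1 + ((0 : ℝ≥0) : ℝ≥0∞)) * ν univ)) := by
    have hcoe : Tendsto (fun ε : ℝ≥0 => (ε : ℝ≥0∞)) (𝓝[>] 0) (𝓝 ((0 : ℝ≥0) : ℝ≥0∞)) :=
      (ENNReal.continuous_coe.tendsto 0).mono_left nhdsWithin_le_nhds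
    refine Tendsto.add (ENNReal.Tendsto.mul_const (ENNReal.Tendsto.const_mul hcoe ?_) ?_)
      (ENNReal.Tendsto.mul_const (tendsto_const_nhds.add hcoe) ?_) <;> simp
  have := ge_of_tendsto hlim (by filter_upwards [self_mem_nhdsWithin] with ε h using hε ε h)
  simpa using this

/-! ### Càdlàg paths of finite variation -/

section Paths

variable {E : Type*} [NormedAddCommGroup E]

theorem IsCadlag.tendsto_leftLim {f : ℝ≥0 → E} (hf : IsCadlag f) (s : ℝ≥0) :
    Tendsto f (𝓝[<] s) (𝓝 (Function.leftLim f s)) :=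
  tendsto_leftLim_of_tendsto (hf.left_lim s)

theorem variation_add_fun_le (f g : ℝ≥0 → E) (a b : ℝ≥0) :
    variation (fun s => f s + g s) a b ≤ variation f a b + variation g a b := by
  refine iSup_le fun p => ?_
  calc ∑ i ∈ Finset.range p.1, edist (f (p.2.1 (i + 1)) + g (p.2.1 (i + 1)))
        (f (p.2.1 i) + g (p.2.1 i))
      ≤ ∑ i ∈ Finset.range p.1, (edist (f (p.2.1 (i + 1))) (f (p.2.1 i)) +
          edist (g (p.2.1 (i + 1))) (g (p.2.1 i))) :=
        Finset.sum_le_sum fun i _ => edist_add_add_le _ _ _ _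
    _ ≤ _ := by
        rw [Finset.sum_add_distrib]
        exact add_le_add (eVariationOn.sum_le p.2.2.1 p.2.2.2)
          (eVariationOn.sum_le p.2.2.1 p.2.2.2)

instance (f : ℝ≥0 → E) (hf : HasFiniteVariation f) (hc : IsCadlag f) :
    IsLocallyFiniteMeasure (variationMeasure f hf hc) := by
  unfold variationMeasure; infer_instance

/-- The atoms of `d|f|` are the jumps of `f`. -/
theorem variationMeasure_singleton (f : ℝ≥0 → E) (hf : HasFiniteVariation f) (hc : IsCadlag f)
    {s : ℝ≥0} (hs : 0 < s) : variationMeasure f hf hc {s} = ‖jump f s‖ₑ := by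
  have : (𝓝[<] s).NeBot := nhdsLT_neBot_of_exists_lt ⟨0, hs⟩
  have h1 : Tendsto (fun u => variation f u s) (𝓝[<] s) (𝓝 ‖jump f s‖ₑ) := by
    have := hf.locallyBoundedVariationOn.tendsto_eVariationOn_Icc_left (x := s)
      (l := Function.leftLim f s) (by simpa using hc.tendsto_leftLim s) (mem_univ s)
    simpa [variation, jump, edist_eq_enorm_sub, enorm_sub_rev] using this
  have h2 : (fun u => variationMeasure f hf hc (Ioc u s)) =ᶠ[𝓝[<] s] fun u => variation f u s := by
    filter_upwards [self_mem_nhdsWithin] with u hu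
    exact variationMeasure_Ioc f hf hc (le_of_lt hu)
  -- So `d|f| (u, s]` tends to `‖Δf_s‖` as `u ↑ s`; it also decreases to `d|f| {s}`.
  have h3 := h1.congr' h2.symm
  refine le_antisymm (ge_of_tendsto h3 ?_) (le_of_forall_gt_imp_ge_of_dense fun c hcs => ?_)
  · filter_upwards [self_mem_nhdsWithin] with u hu
    exact measure_mono (singleton_subset_iff.2 ⟨hu, le_rfl⟩)
  · exact le_of_tendsto h3 ((eventually_measure_Ioc_lt hs hcs).mono fun u hu => hu.le)

/-- The path `f` frozen outside `[a, b]`: constant before `a` and after `b`. A path of finite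
variation on `[a, b]` only, thus becomes one of finite variation on `[0, ∞)`, to which
`variationMeasure` applies. -/
def freeze {F : Type*} (f : ℝ≥0 → F) (a b : ℝ≥0) : ℝ≥0 → F := fun s => f (max a (min s b))

theorem freeze_of_mem {F : Type*} {f : ℝ≥0 → F} {a b s : ℝ≥0} (hs : s ∈ Icc a b) :
    freeze f a b s = f s := by
  rw [freeze, min_eq_left hs.2, max_eq_right hs.1]

theorem variation_freeze {f : ℝ≥0 → E} {a b u s : ℝ≥0} (hu : a ≤ u) (hs : s ≤ b) :
    variation (freeze f a b) u s = variation f u s :=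
  eVariationOn.congr fun _ hr => freeze_of_mem ⟨hu.trans hr.1, hr.2.trans hs⟩

theorem hasFiniteVariation_freeze {f : ℝ≥0 → E} {a b : ℝ≥0} (hab : a ≤ b)
    (hf : variation f a b < ∞) : HasFiniteVariation (freeze f a b) := by
  intro s
  refine lt_of_le_of_lt ?_ hf
  refine eVariationOn.comp_le_of_monotoneOn f (fun r => max a (min r b)) ?_ ?_
  · intro r _ r' _ hrr
    dsimp only
    gcongr
  · exact fun r _ => ⟨le_max_left _ _, max_le hab (min_le_right _ _)⟩

theorem IsCadlag.freeze [CompleteSpace E] {f : ℝ≥0 → E} (hf : IsCadlag f) {a b : ℝ≥0} (hab : a ≤ b)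
    (hfin : variation f a b < ∞) : IsCadlag (freeze f a b) where
  right_cont s := by
    refine (hf.right_cont _).comp (t := Ici (max a (min s b))) (f := fun r => max a (min r b))
      (by fun_prop) ?_
    intro r hr
    simp only [mem_Ici] at hr ⊢
    gcongr
  left_lim s := by
    have hbv : BoundedVariationOn (Skorokhod.freeze f a b) (Icc 0 s) :=
      (hasFiniteVariation_freeze hab hfin s).ne
    obtain ⟨l, hl⟩ := hbv.exists_tendsto_left s
    refine ⟨l, hl.mono_left (nhdsWithin_mono _ fun r hr => ⟨⟨zero_le, le_of_lt hr⟩, hr⟩)⟩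

theorem jump_freeze {f : ℝ≥0 → E} (hf : IsCadlag f) {a b s : ℝ≥0} (hs : s ∈ Ioc a b) :
    jump (freeze f a b) s = jump f s := by
  have : (𝓝[<] s).NeBot := nhdsLT_neBot_of_exists_lt ⟨a, hs.1⟩
  have hl : Function.leftLim (freeze f a b) s = Function.leftLim f s := by
    refine leftLim_eq_of_tendsto ((hf.tendsto_leftLim s).congr' ?_)
    filter_upwards [Ioo_mem_nhdsLT hs.1] with u hu
    exact (freeze_of_mem ⟨hu.1.le, hu.2.le.trans hs.2⟩).symm
  rw [jump, jump, hl, freeze_of_mem ⟨hs.1.le, hs.2⟩]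

end Paths

/-! ### Exterior balls and the Skorokhod problem -/

section Domain

variable {E : Type*} [NormedAddCommGroup E] [InnerProductSpace ℝ E]

/-- Being open, the exterior ball at `x` misses `closure D` as well as `D`. So for `z ∈ closure D`
the difference `z - x` can point against `n` only to second order. -/
theorem inner_sub_le_of_mem_normalsAt {D : Set E} {x z n : E} {r : ℝ} (hr : 0 < r)
    (hn : n ∈ normalsAt D x r) (hz : z ∈ closure D) :
    inner ℝ n (x - z) ≤ ‖x - z‖ ^ 2 / (2 * r) := by
  obtain ⟨hn1, hball⟩ := hn
  have hz' : z ∉ Metric.ball (x - r • n) r := fun h =>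
    ((disjoint_iff_inter_eq_empty.2 hball).closure_right Metric.isOpen_ball).le_bot ⟨h, hz⟩
  rw [Metric.mem_ball, not_lt, dist_comm, dist_eq_norm] at hz'
  have h1 : x - r • n - z = (x - z) - r • n := by abel
  rw [h1] at hz'
  have h2 := pow_le_pow_left₀ hr.le hz' 2
  rw [norm_sub_sq_real, norm_smul, hn1, Real.norm_of_nonneg hr.le, inner_smul_right,
    real_inner_comm] at h2
  rw [le_div_iff₀ (by positivity)]
  linarith

theorem exists_mem_normalsAt {D : Set E} {x n : E} (hn : n ∈ normals D x) :
    ∃ r, 0 < r ∧ n ∈ normalsAt D x r := by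
  simpa [normals] using hn

namespace IsSolution

variable {D : Set E} {y x k : ℝ≥0 → E}

/-- The reflection term jumps by at most the jump of the input: `x_{s-}` is a
competitor in the projection of `x_{s-} + Δy_s`. -/
theorem norm_jump_le (h : IsSolution D y x k) (hy : IsCadlag y) {s : ℝ≥0} (hs : 0 < s) :
    ‖jump k s‖ ≤ ‖jump y s‖ := by
  have : (𝓝[<] s).NeBot := nhdsLT_neBot_of_exists_lt ⟨0, hs⟩
  have hl : Function.leftLim x s = Function.leftLim y s + Function.leftLim k s :=
    leftLim_eq_of_tendsto (((hy.tendsto_leftLim s).add (h.cadlag_k.tendsto_leftLim s)).congr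
      fun u => (h.eq_add u).symm)
  have hmem : Function.leftLim x s ∈ closure D :=
    isClosed_closure.mem_of_tendsto (h.cadlag_x.tendsto_leftLim s)
      (Eventually.of_forall h.mem_closure)
  calc ‖jump k s‖ = dist (Function.leftLim x s + jump y s) (x s) := by
        rw [dist_comm, dist_eq_norm, h.eq_add s, hl, jump, jump]
        congr 1
        abel
    _ ≤ dist (Function.leftLim x s + jump y s) (Function.leftLim x s) := by
        rw [h.jump_projection s hs]
        exact Metric.infDist_le_dist_of_mem hmem
    _ = ‖jump y s‖ := by simp

theorem ae_mem_frontier (h : IsSolution D y x k) (q : ℝ≥0) :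
    ∀ᵐ s ∂(variationMeasure k h.finite_variation h.cadlag_k).restrict (Ioc 0 q),
      x s ∈ frontier D := by
  have hq := h.variation_on_frontier q
  rw [← variationMeasure_Ioc k h.finite_variation h.cadlag_k zero_le] at hq
  have hne : variationMeasure k h.finite_variation h.cadlag_k (Ioc 0 q) ≠ ∞ := by
    rw [variationMeasure_Ioc _ _ _ zero_le]
    exact (h.finite_variation q).ne
  -- The comparison asks for measurability of the constant `1` only, not of the indicator.
  have hae := ae_eq_of_ae_le_of_lintegral_le (g := fun _ => (1 : ℝ≥0∞))
    (Eventually.of_forall fun s => indicator_le_self' (fun _ _ => zero_le) s)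
    (hq ▸ hne) aemeasurable_const (by simpa using hq.le)
  filter_upwards [hae] with s hs
  by_contra hcon
  simp [hcon] at hs

end IsSolution

/-- The total variation of `k` is dominated by that of `y`, stated for finite variation of `y`. -/
theorem IsSolution.variation_le_of_lt_top [CompleteSpace E] [SecondCountableTopology E]
    {D : Set E} {y x k : ℝ≥0 → E} (h : IsSolution D y x k) (hy : IsCadlag y) {t q : ℝ≥0}
    (htq : t ≤ q) (hfin : variation y t q < ∞) : variation k t q ≤ variation y t q := by
  obtain ⟨n, hn, hnint⟩ := h.normal_integral
  set μ := variationMeasure k h.finite_variation h.cadlag_k with hμ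
  let ν := variationMeasure (freeze y t q) (hasFiniteVariation_freeze htq hfin) (hy.freeze htq hfin)
  have hμI : ∀ {u s}, u ≤ s → μ (Ioc u s) = variation k u s :=
    fun hus => variationMeasure_Ioc _ _ _ hus
  have hνI : ∀ {u s}, t ≤ u → u ≤ s → s ≤ q → ν (Ioc u s) = variation y u s :=
    fun htu hus hsq => (variationMeasure_Ioc _ _ _ hus).trans (variation_freeze htu hsq)
  have hμtop : μ (Ioc t q) ≠ ∞ := measure_Ioc_lt_top.ne
  have hνtop : ν (Ioc t q) ≠ ∞ := measure_Ioc_lt_top.ne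
  have : IsFiniteMeasure (μ.restrict (Ioc t q)) := ⟨by simpa using hμtop.lt_top⟩
  have : IsFiniteMeasure (ν.restrict (Ioc t q)) := ⟨by simpa using hνtop.lt_top⟩
  have hsub : Ioc t q ⊆ Ioc 0 q := Ioc_subset_Ioc_left zero_le
  have hgood : ∀ᵐ s ∂μ.restrict (Ioc t q), s ∈ Ioc t q ∧ x s ∈ frontier D := by
    filter_upwards [ae_restrict_mem measurableSet_Ioc,
      ae_restrict_of_ae_restrict_of_subset hsub (h.ae_mem_frontier q)] with s h1 h2 using ⟨h1, h2⟩
  have hmain := measure_le_of_inner_integral_le (μ := μ.restrict (Ioc t q))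
    (ν := ν.restrict (Ioc t q)) (n := n) ((hnint q).1.mono_set hsub).aestronglyMeasurable
    (by
      filter_upwards [hgood] with s hs
      obtain ⟨r, -, hr⟩ := exists_mem_normalsAt (hn s hs.2)
      exact hr.1) ?_
  · rwa [Measure.restrict_apply_univ, Measure.restrict_apply_univ, hμI htq,
      hνI le_rfl htq le_rfl] at hmain
  intro ε hε
  filter_upwards [hgood] with s hs
  obtain ⟨hstq, hsD⟩ := hs
  have hs0 : 0 < s := zero_le.trans_lt hstq.1
  refine ⟨hs0, ?_⟩
  obtain ⟨r, hr0, hr⟩ := exists_mem_normalsAt (hn s hsD)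
  -- Only intervals `(u, s] ⊆ (t, q]` matter, and on them the restrictions can be dropped.
  suffices hev : ∀ᶠ u in 𝓝[<] s, t ≤ u → u ≤ s → inner ℝ (n s) (k s - k u) ≤
      ε * (μ.real (Ioc u s) + ν.real (Ioc u s)) + ν.real (Ioc u s) by
    filter_upwards [hev, Ioo_mem_nhdsLT hstq.1] with u hu htus
    have hsub' : Ioc u s ⊆ Ioc t q := Ioc_subset_Ioc htus.1.le hstq.2
    have hrestr : ∀ ρ : Measure ℝ≥0, (ρ.restrict (Ioc t q)).real (Ioc u s) = ρ.real (Ioc u s) :=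
      fun ρ => by
        rw [measureReal_restrict_apply measurableSet_Ioc, inter_eq_self_of_subset_left hsub']
    have hint : ∫ r in Ioc u s, n r ∂μ.restrict (Ioc t q) = k s - k u := by
      rw [Measure.restrict_restrict measurableSet_Ioc, inter_eq_self_of_subset_left hsub',
        (hnint s).2, (hnint u).2, ← Ioc_union_Ioc_eq_Ioc zero_le htus.2.le,
        setIntegral_union (Ioc_disjoint_Ioc_of_le le_rfl) measurableSet_Ioc (hnint u).1
          ((hnint s).1.mono_set (Ioc_subset_Ioc_left zero_le)), add_sub_cancel_left]
    rw [hint, hrestr, hrestr]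
    exact hu htus.1.le htus.2.le
  have hμk : ∀ {u}, u ≤ s → ‖k s - k u‖ ≤ μ.real (Ioc u s) := by
    intro u hus
    rw [← toReal_enorm, ← edist_eq_enorm_sub]
    refine ENNReal.toReal_mono measure_Ioc_lt_top.ne ?_
    rw [hμI hus]
    exact eVariationOn.edist_le k ⟨hus, le_rfl⟩ ⟨le_rfl, hus⟩
  have hνy : ∀ {u}, t ≤ u → u ≤ s → ‖y s - y u‖ ≤ ν.real (Ioc u s) := by
    intro u htu hus
    rw [← toReal_enorm, ← edist_eq_enorm_sub]
    refine ENNReal.toReal_mono measure_Ioc_lt_top.ne ?_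
    rw [hνI htu hus hstq.2]
    exact eVariationOn.edist_le y ⟨hus, le_rfl⟩ ⟨le_rfl, hus⟩
  have hatom : μ {s} ≤ ν {s} := by
    rw [hμ, variationMeasure_singleton _ _ _ hs0, variationMeasure_singleton _ _ _ hs0,
      jump_freeze hy hstq]
    exact enorm_le_iff_norm_le.2 (h.norm_jump_le hy hs0)
  rcases eq_or_ne (ν {s}) 0 with hν0 | hν0
  · -- No atom at `s`: `x` is left continuous there and the quadratic term is negligible.
    have hμ0 : μ {s} = 0 := le_antisymm (hatom.trans hν0.le) zero_le
    let c : ℝ≥0 := ε * r.toNNReal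
    have hc : (0 : ℝ≥0∞) < c := by
      have := Real.toNNReal_pos.2 hr0
      exact ENNReal.coe_pos.2 (by positivity)
    filter_upwards [eventually_measure_Ioc_lt hs0 (hμ0.symm ▸ hc : μ {s} < c),
      eventually_measure_Ioc_lt hs0 (hν0.symm ▸ hc : ν {s} < c)] with u hμu hνu htu hus
    have hμu' : μ.real (Ioc u s) ≤ ε * r := by
      have := ENNReal.toReal_mono ENNReal.coe_ne_top hμu.le
      simpa [c, hr0.le, measureReal_def] using this
    have hνu' : ν.real (Ioc u s) ≤ ε * r := by
      have := ENNReal.toReal_mono ENNReal.coe_ne_top hνu.le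
      simpa [c, hr0.le, measureReal_def] using this
    have hxn : ‖x s - x u‖ ≤ μ.real (Ioc u s) + ν.real (Ioc u s) := by
      have e : x s - x u = (k s - k u) + (y s - y u) := by rw [h.eq_add, h.eq_add]; abel
      rw [e]
      exact (norm_add_le _ _).trans (add_le_add (hμk hus) (hνy htu hus))
    have hquad : ‖x s - x u‖ ^ 2 / (2 * r) ≤ ε * (μ.real (Ioc u s) + ν.real (Ioc u s)) := by
      rw [div_le_iff₀ (by positivity)]
      calc ‖x s - x u‖ ^ 2 ≤ (μ.real (Ioc u s) + ν.real (Ioc u s)) ^ 2 := by gcongr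
        _ = (μ.real (Ioc u s) + ν.real (Ioc u s)) * (μ.real (Ioc u s) + ν.real (Ioc u s)) := sq _
        _ ≤ (μ.real (Ioc u s) + ν.real (Ioc u s)) * (ε * r + ε * r) := by gcongr
        _ = ε * (μ.real (Ioc u s) + ν.real (Ioc u s)) * (2 * r) := by ring
    have hnx := inner_sub_le_of_mem_normalsAt hr0 hr (h.mem_closure u)
    have hny : -inner ℝ (n s) (y s - y u) ≤ ν.real (Ioc u s) := by
      have := neg_le_abs (inner ℝ (n s) (y s - y u))
      refine (this.trans (abs_real_inner_le_norm _ _)).trans ?_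
      rw [hr.1, one_mul]
      exact hνy htu hus
    have e : k s - k u = (x s - x u) - (y s - y u) := by rw [h.eq_add, h.eq_add]; abel
    rw [e, inner_sub_right]
    linarith
  · -- An atom of `ν` at `s` absorbs `μ (u, s]`, which tends to `μ {s} ≤ ν {s}`.
    have hνs : ν {s} ≠ ∞ := isCompact_singleton.measure_lt_top.ne
    have hlt : μ {s} < (1 + ε) * ν {s} := by
      refine hatom.trans_lt ?_
      rw [add_mul, one_mul]
      exact ENNReal.lt_add_right hνs (mul_ne_zero (ENNReal.coe_pos.2 hε).ne' hν0)
    filter_upwards [eventually_measure_Ioc_lt hs0 hlt, self_mem_nhdsWithin] with u hu hus' htu hus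
    have h1 : μ (Ioc u s) ≤ (1 + ε) * ν (Ioc u s) := hu.le.trans (by
      gcongr
      exact singleton_subset_iff.2 ⟨hus', le_rfl⟩)
    have h2 : μ.real (Ioc u s) ≤ (1 + ε) * ν.real (Ioc u s) := by
      have := ENNReal.toReal_mono (ENNReal.mul_ne_top (by simp) measure_Ioc_lt_top.ne) h1
      rwa [ENNReal.toReal_mul, ENNReal.toReal_add (by simp) (by simp)] at this
    have h3 : inner ℝ (n s) (k s - k u) ≤ μ.real (Ioc u s) := by
      refine (real_inner_le_norm _ _).trans ?_
      rw [hr.1, one_mul]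
      exact hμk hus
    have h4 : (0 : ℝ) ≤ ε * μ.real (Ioc u s) := by positivity
    linarith

end Domain

end Skorokhod

theorem lemma1 (d : ℕ) (D : Set (EuclideanSpace ℝ (Fin d)))
    (hDopen : IsOpen D) (hDconn : IsConnected D)
    (r₀ : ℝ≥0∞) (hA : Skorokhod.ConditionA D r₀) (hB : Skorokhod.ConditionB D)
    (y : ℝ≥0 → EuclideanSpace ℝ (Fin d)) (hy : Skorokhod.IsCadlag y)
    (hy0 : y 0 ∈ closure D)
    (hjump : ∀ t, ENNReal.ofReal ‖Skorokhod.jump y t‖ < r₀)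
    (x k : ℝ≥0 → EuclideanSpace ℝ (Fin d)) (hxk : Skorokhod.IsSolution D y x k)
    (t q : ℝ≥0) (htq : t < q) :
    Skorokhod.variation k t q ≤ Skorokhod.variation y t q ∧
      Skorokhod.variation x t q ≤ 2 * Skorokhod.variation y t q := by
  have hk : Skorokhod.variation k t q ≤ Skorokhod.variation y t q := by
    rcases eq_or_ne (Skorokhod.variation y t q) ∞ with htop | hne
    · exact htop ▸ le_top
    · exact hxk.variation_le_of_lt_top hy htq.le hne.lt_top
  refine ⟨hk, ?_⟩
  rw [show x = fun s => y s + k s from funext hxk.eq_add, two_mul]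
  exact (Skorokhod.variation_add_fun_le y k t q).trans (by gcongr)
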